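/- Let $\mathbb Z_2[z^{\pm}]$ be the ring of Laurent polynomials over the field with two elements. A $\delta$-parametric polynomial is a finite sum $\mathbf f=\sum_{i=s}^{t} f_i(z)z^{i\delta}$ with $f_i\in\mathbb Z_2[z^{\pm}]$; for $\delta\in\mathbb Z$ let $\mathbf f_\delta\in\mathbb Z_2[z^{\pm}]$ be the Laurent polynomial obtained by substituting this value of $\delta$. It is nontrivial if some $f_i\neq0$; we then take $f_s\ne0\ne f_t$ and put $\deg_\delta(\mathbf f)=t$, $\operatorname{ord}_\delta(\mathbf f)=s$. For integers $A\ge0$, $p\ge1$, a sequence $(F_\delta)_{\delta\ge0}$ in $\mathbb Z_2[z^{\pm}]$ is called $(A,p)$-periodic if there are integers $s'\le t'$, bit strings $n_{s'},\dots,n_{t'}\in\{0,1\}^{2A+1}$ and $u_{s'},\dots,u_{t'-1}\in\{0,1\}^{p}$ such that for all sufficiently large $\delta$ the coefficients of $F_\delta$ at the exponents $s'\delta-A,\dots,t'\delta+A$ (in increasing order) form the string $n_{s'}\,u_{s'}^{(\delta-2A-1)}\,n_{s'+1}\cdots u_{t'-1}^{(\delta-2A-1)}\,n_{t'}$ and all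 other coefficients vanish, where $u^{(k)}$ is the initial segment of length $k$ of $uuu\cdots$. For $0\ne h\in\mathbb Z_2[z^{\pm}]$ let $H=z^{-\operatorname{ord}(h)}h\in\mathbb Z_2[z]$, where $\operatorname{ord}(h)$ is the least exponent occurring in $h$. The division-by-$H$ automaton has as states the polynomials in $\mathbb Z_2[z]$ of degree less than $\deg H$, and reading the letter $b\in\{0,1\}$ in state $q$ leads to the remainder of $qz+b$ modulo $H$. Let $P_h$ be the least positive integer $P$ such that for every word $w\in\{0,1\}^*$ and every state $q$, reading $w^P$ from $q$ leads back to $q$ (such $P$ exist). **Corollary.** Let $\mathbf f=\sum_{i=s}^t f_i(z)z^{i\delta}$ (with $f_s\ne0\ne f_t$) and $\mathbf g$ be nontrivial $\delta$-parametric polynomials, and let $A\le B$ be non-negative integers such that $(\mathbf f_\delta)_{\delta\ge0}$ is $(A,1)$-periodic and $(\mathbf g_\delta)_{\delta\ge0}$ is $(B,1)$-periodic. Put $$\Delta=[\deg_\delta(\mathbf g)-\operatorname{ord}_\delta(\mathbf g)]-[\deg_\delta(\mathbf f)-\operatorname{ord}_\delta(\mathbf f)].$$ Suppose that $\mathbf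 f_\delta\mid\mathbf g_\delta$ in $\mathbb Z_2[z^{\pm}]$ for some $\delta\in\mathbb Z$. - If $\Delta\ge0$, then there is such a $\delta$ with $$-\bigl(P_{f_s}^{\Delta}+2(B+4A\Delta)+4A+1\bigr)\le\delta\le P_{f_t}^{\Delta}+2(B+4A\Delta)+4A+1 .$$ - If $\Delta<0$, then there is such a $\delta$ with $-(2B+2A)\le\delta\le 2B+2A$. -/

import Mathlib

open scoped LaurentPolynomial Polynomial

noncomputable section

namespace ParamDiv

/-- Laurent polynomials over the field with two elements. -/
abbrev Laurent : Type := (ZMod 2)[T;T⁻¹]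

/-- The largest element of a finite set of integers (`0` for the empty set). -/
def maxIdx (S : Finset ℤ) : ℤ := if h : S.Nonempty then S.max' h else 0

/-- The smallest element of a finite set of integers (`0` for the empty set). -/
def minIdx (S : Finset ℤ) : ℤ := if h : S.Nonempty then S.min' h else 0

/-- The order of a Laurent polynomial `h ≠ 0`: its least exponent. -/
def order (h : Laurent) : ℤ := minIdx h.coeff.support

/-- The ordinary polynomial `z ^ (-order h) * h`. -/
def toPoly (h : Laurent) : (ZMod 2)[X] :=
  ∑ j ∈ h.coeff.support, Polynomial.monomial (j - order h).toNat (h.coeff j)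

/-! ### Parametric polynomials -/

/-- A `δ`-parametric polynomial `∑ i, f i * z ^ (i * δ)`, given by its finitely many
nonzero blocks `f i`. -/
abbrev ParamPoly : Type := ℤ →₀ Laurent

/-- The Laurent polynomial obtained by giving the parameter the value `δ`. -/
def inst (f : ParamPoly) (δ : ℤ) : Laurent :=
  f.sum fun i h => h * LaurentPolynomial.T (i * δ)

/-- The `δ`-degree of a nontrivial parametric polynomial: the index of its last nonzero block. -/
def degδ (f : ParamPoly) : ℤ := maxIdx f.support

/-- The `δ`-order of a nontrivial parametric polynomial: the index of its first nonzero block. -/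
def ordδ (f : ParamPoly) : ℤ := minIdx f.support

/-- The difference of the `δ`-spans of `g` and `f`. -/
def spanDiff (f g : ParamPoly) : ℤ := (degδ g - ordδ g) - (degδ f - ordδ f)

/-! ### Piecewise periodic sequences -/

/-- The sequence `F 0, F 1, …` is `(A, p)`-piecewise periodic: there are integers `s ≤ t`,
bit strings `n s, …, n t` of length `2 * A + 1`, bit strings `u s, …, u (t - 1)` of length `p`
and a threshold `D` such that for all `δ ≥ D` the coefficients of `F δ` at the exponents
`s * δ - A, …, t * δ + A`, in increasing order, are
`n s ∘ u s ^ (δ - 2A - 1) ∘ n (s + 1) ∘ ⋯ ∘ u (t - 1) ^ (δ - 2A - 1) ∘ n t`, and all others vanish.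
Here `u ^ (k)` is the initial segment of length `k` of the periodic string `u u u …`. -/
def IsPiecewisePeriodic (A p : ℕ) (F : ℕ → Laurent) : Prop :=
  0 < p ∧
  ∃ (s t : ℤ) (n : ℤ → Fin (2 * A + 1) → ZMod 2) (u : ℤ → Fin p → ZMod 2) (D : ℕ),
    s ≤ t ∧ 2 * A + 1 ≤ D ∧ ∀ δ : ℕ, D ≤ δ →
      (∀ i : ℤ, s ≤ i → i ≤ t → ∀ k : Fin (2 * A + 1),
        (F δ).coeff (i * δ - A + (k : ℕ)) = n i k) ∧
      (∀ i : ℤ, s ≤ i → i < t → ∀ (k : ℕ) (c : Fin p), k < δ - 2 * A - 1 → (c : ℕ) = k % p →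
        (F δ).coeff (i * δ + A + 1 + k) = u i c) ∧
      (∀ e : ℤ, e < s * δ - A ∨ t * δ + A < e → (F δ).coeff e = 0)

/-! ### The division automaton -/

/-- The transition, labelled `b`, of the division-by-`F` automaton from the state `s`.
The states are the polynomials of degree less than `F.degree`. -/
def step (F s : (ZMod 2)[X]) (b : ZMod 2) : (ZMod 2)[X] :=
  (s * Polynomial.X + Polynomial.C b) % F

/-- The state reached from `s` by reading the word `w`. -/
def run (F s : (ZMod 2)[X]) (w : List (ZMod 2)) : (ZMod 2)[X] := w.foldl (step F) s

/-- `P` is positive and reading `w ^ P` returns to the initial state,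
for every word `w` and every initial state. -/
def IsReturnExponent (F : (ZMod 2)[X]) (P : ℕ) : Prop :=
  0 < P ∧ ∀ (w : List (ZMod 2)) (s : (ZMod 2)[X]), s.degree < F.degree →
    run F s (List.replicate P w).flatten = s

/-- The least return exponent of the division automaton. -/
def returnExponent (F : (ZMod 2)[X]) : ℕ := sInf {P : ℕ | IsReturnExponent F P}

/-- The period constant of a nonzero Laurent polynomial. -/
def periodConst (h : Laurent) : ℕ := returnExponent (toPoly h)



/-- A polynomial with nonzero constant term has a return exponent. -/
theorem exists_isReturnExponent (F : (ZMod 2)[X]) (hF : F.coeff 0 ≠ 0) :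
    ∃ P : ℕ, IsReturnExponent F P := by
  have hF0 : F ≠ 0 := by rintro rfl; simp at hF
  let S : Type := {s : (ZMod 2)[X] // s.degree < F.degree}
  have hS : Finite S := by
    have : Finite (Polynomial.degreeLT (ZMod 2) F.natDegree) :=
      Finite.of_equiv _ (Polynomial.degreeLTEquiv (ZMod 2) F.natDegree).symm.toEquiv
    refine Finite.of_injective
      (fun s : S => (⟨s.1, Polynomial.mem_degreeLT.2 (by
        rw [← Polynomial.degree_eq_natDegree hF0]; exact s.2)⟩ :
          Polynomial.degreeLT (ZMod 2) F.natDegree)) ?_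
    intro a b h
    exact Subtype.ext (congrArg (fun x => x.1) h)
  have hstep : ∀ s b, (step F s b).degree < F.degree := fun s b =>
    Polynomial.degree_mod_lt _ hF0
  have hcop : IsCoprime F Polynomial.X := by
    refine ((Polynomial.irreducible_X.coprime_iff_not_dvd).2 ?_).symm
    rwa [Polynomial.X_dvd_iff]
  let st : ZMod 2 → S → S := fun b s => ⟨step F s.1 b, hstep _ _⟩
  have hinj : ∀ b, Function.Injective (st b) := by
    intro b s s' h
    have h1 : (s.1 * Polynomial.X + Polynomial.C b) % F =
        (s'.1 * Polynomial.X + Polynomial.C b) % F := congrArg Subtype.val h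
    have h2 : F ∣ (s.1 - s'.1) * Polynomial.X := by
      have ha := EuclideanDomain.div_add_mod (s.1 * Polynomial.X + Polynomial.C b) F
      have hb := EuclideanDomain.div_add_mod (s'.1 * Polynomial.X + Polynomial.C b) F
      refine ⟨(s.1 * Polynomial.X + Polynomial.C b) / F -
        (s'.1 * Polynomial.X + Polynomial.C b) / F, ?_⟩
      linear_combination h1 - ha + hb
    have h3 : F ∣ s.1 - s'.1 := hcop.dvd_of_dvd_mul_right h2
    have h4 : s.1 - s'.1 = 0 := Polynomial.eq_zero_of_dvd_of_degree_lt h3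
      (lt_of_le_of_lt (Polynomial.degree_sub_le _ _) (max_lt s.2 s'.2))
    exact Subtype.ext (sub_eq_zero.1 h4)
  let e : ZMod 2 → Equiv.Perm S := fun b =>
    Equiv.ofBijective (st b) (Finite.injective_iff_bijective.1 (hinj b))
  let E : List (ZMod 2) → Equiv.Perm S := fun w => (w.reverse.map e).prod
  have hE : ∀ (w : List (ZMod 2)) (s : S), run F s.1 w = (E w s).1 := by
    intro w
    induction w with
    | nil => intro s; rfl
    | cons b w ih =>
      intro s
      have : run F s.1 (b :: w) = run F (st b s).1 w := rfl
      rw [this, ih]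
      simp [E, e]
  have hE' : ∀ (w : List (ZMod 2)) (k : ℕ), E (List.replicate k w).flatten = E w ^ k := by
    intro w k
    induction k with
    | zero => simp [E]
    | succ k ih =>
      have : E (List.replicate (k + 1) w).flatten = E (List.replicate k w).flatten * E w := by
        simp [E, List.replicate_succ]
      rw [this, ih, pow_succ]
  refine ⟨Nat.card (Equiv.Perm S), Nat.card_pos, ?_⟩
  intro w s hs
  have := hE (List.replicate (Nat.card (Equiv.Perm S)) w).flatten ⟨s, hs⟩
  rw [hE', pow_card_eq_one'] at this
  exact this

/-- `toPoly h` has a nonzero constant term. -/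
theorem toPoly_coeff_zero {h : Laurent} (hh : h ≠ 0) : (toPoly h).coeff 0 ≠ 0 := by
  have hne : h.coeff.support.Nonempty := by
    rw [Finsupp.support_nonempty_iff]
    intro h0
    exact hh (by ext; simp [h0])
  have ho : order h = h.coeff.support.min' hne := by simp [order, minIdx, hne]
  have hmem : order h ∈ h.coeff.support := ho ▸ Finset.min'_mem _ _
  have : (toPoly h).coeff 0 = h.coeff (order h) := by
    rw [toPoly, Polynomial.finsetSum_coeff, Finset.sum_eq_single (order h)]
    · simp
    · intro j hj hne'
      have : order h ≤ j := ho ▸ Finset.min'_le _ _ hj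
      rw [Polynomial.coeff_monomial, if_neg]
      omega
    · intro h1; exact absurd hmem h1
  rw [this]
  exact Finsupp.mem_support_iff.1 hmem

/-- The period constant is itself a return exponent. -/
theorem periodConst_spec {h : Laurent} (hh : h ≠ 0) :
    IsReturnExponent (toPoly h) (periodConst h) :=
  Nat.sInf_mem (exists_isReturnExponent _ (toPoly_coeff_zero hh))

/-- It is bounded by every other return exponent. -/
theorem periodConst_le {h : Laurent} {P : ℕ} (hP : IsReturnExponent (toPoly h) P) :
    periodConst h ≤ P := Nat.sInf_le hP

end ParamDiv

end

open scoped LaurentPolynomial Polynomial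

namespace ParamDiv

/-! ### Laurent polynomials supported near the origin -/

/-! With `x = z^δ`, a parametric polynomial is, up to a unit, an ordinary polynomial in `x` over the
Laurent ring. Let `F`, `G` be the polynomials of `f`, `g` (`blockPoly`). Period 1 forces their
coefficients to have exponents in `[-A, A]` and `[-B, B]`, so for large `δ` the blocks do not
overlap and spans can be read off.

If `Δ < 0`, comparing the spans of `F(z^δ)` and `G(z^δ)` already bounds `δ` (`natDegree_span_le`).

If `Δ ≥ 0`, let `c` be the leading coefficient of `F` and pseudo-divide: `c^(Δ+1) G = F Q + r`
(`exists_pseudo_div`). Divisibility at one large `δ` makes `F(z^δ)` divide `r(z^δ)`, whose span is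
too small, so `r = 0`. Hence at every `δ`, `F(z^δ) ∣ G(z^δ)` as soon as `c^(Δ+1) ∣ Q(z^δ)`. Now
`c^j` divides the `j`-th coefficient of `Q`, and `c^Δ ∣ z^R - 1` for `R = P_c^Δ`
(`pow_dvd_T_sub_one`), so `Q(z^δ)` modulo `c^(Δ+1)` depends only on `δ` modulo `R`. A large solution
can therefore be replaced by its residue modulo `R`.

Negative `δ` reduce to positive ones by `δ ↦ -δ`, which exchanges the first and last blocks. -/

theorem coeff_mul_T (h : Laurent) (n e : ℤ) :
    (h * LaurentPolynomial.T n).coeff e = h.coeff (e - n) := by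
  rw [LaurentPolynomial.T, AddMonoidAlgebra.coeff_mul_single_apply, mul_one, sub_eq_add_neg]

/-- Every exponent of `h` lies in `[-N, N]`. -/
def BlockWidth (N : ℕ) (h : Laurent) : Prop := ∀ e : ℤ, h.coeff e ≠ 0 → |e| ≤ N

theorem BlockWidth.zero (N : ℕ) : BlockWidth N 0 := fun _ he => absurd rfl he

theorem BlockWidth.mono {M N : ℕ} (hMN : M ≤ N) {h : Laurent} (hh : BlockWidth M h) :
    BlockWidth N h := fun e he => (hh e he).trans (by exact_mod_cast hMN)

theorem BlockWidth.sub {N : ℕ} {a b : Laurent} (ha : BlockWidth N a) (hb : BlockWidth N b) :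
    BlockWidth N (a - b) := by
  intro e he
  by_cases h1 : a.coeff e = 0
  · refine hb e fun h2 => he ?_
    rw [AddMonoidAlgebra.coeff_sub, Finsupp.sub_apply, h1, h2, sub_zero]
  · exact ha e h1

theorem BlockWidth.mul {M N : ℕ} {a b : Laurent} (ha : BlockWidth M a) (hb : BlockWidth N b) :
    BlockWidth (M + N) (a * b) := by
  classical
  intro e he
  have := AddMonoidAlgebra.support_coeff_mul_subset a b (Finsupp.mem_support_iff.2 he)
  obtain ⟨x, hx, y, hy, rfl⟩ := Finset.mem_add.1 this
  refine (abs_add_le x y).trans ?_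
  push_cast
  exact add_le_add (ha x (Finsupp.mem_support_iff.1 hx)) (hb y (Finsupp.mem_support_iff.1 hy))

theorem exists_blockWidth (h : Laurent) : ∃ N, BlockWidth N h := by
  refine ⟨h.coeff.support.sup Int.natAbs, fun e he => ?_⟩
  have := Finset.le_sup (f := Int.natAbs) (Finsupp.mem_support_iff.2 he)
  rw [Int.abs_eq_natAbs]
  exact_mod_cast this

/-- A nonzero Laurent polynomial spans at least as many exponents as any of its divisors. -/
theorem span_le_of_dvd {a b : Laurent} (hab : a ∣ b) (hb : b ≠ 0) {l u x y : ℤ}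
    (hl : a.coeff l ≠ 0) (hu : a.coeff u ≠ 0)
    (hxy : ∀ e, b.coeff e ≠ 0 → x ≤ e ∧ e ≤ y) : u - l ≤ y - x := by
  obtain ⟨q, rfl⟩ := hab
  have hne : ∀ {p : Laurent}, p ≠ 0 → p.coeff.support.Nonempty := fun hp =>
    Finsupp.support_nonempty_iff.2 (AddMonoidAlgebra.coeff_eq_zero.not.2 hp)
  have ha := hne (left_ne_zero_of_mul hb)
  have hq := hne (right_ne_zero_of_mul hb)
  -- The two extreme exponents of a product each arise from a single pair, so nothing cancels there
  -- and spans add.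
  have key : ∀ m n, m ∈ a.coeff.support → n ∈ q.coeff.support →
      UniqueAdd a.coeff.support q.coeff.support m n → x ≤ m + n ∧ m + n ≤ y := by
    intro m n hm hn h
    apply hxy
    rw [AddMonoidAlgebra.coeff_mul_add_of_uniqueAdd h]
    exact mul_ne_zero (Finsupp.mem_support_iff.1 hm) (Finsupp.mem_support_iff.1 hn)
  have h1 := key _ _ (Finset.max'_mem _ ha) (Finset.max'_mem _ hq) (by
    intro m n hm hn h
    have := Finset.le_max' _ _ hm
    have := Finset.le_max' _ _ hn
    omega)
  have h2 := key _ _ (Finset.min'_mem _ ha) (Finset.min'_mem _ hq) (by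
    intro m n hm hn h
    have := Finset.min'_le _ _ hm
    have := Finset.min'_le _ _ hn
    omega)
  have h3 := Finset.le_max' _ _ (Finsupp.mem_support_iff.2 hu)
  have h4 := Finset.min'_le _ _ (Finsupp.mem_support_iff.2 hl)
  have h5 := Finset.min'_le_max' _ hq
  omega

theorem exists_coeff_ne_zero {h : Laurent} (hh : h ≠ 0) : ∃ e, h.coeff e ≠ 0 := by
  by_contra! H
  exact hh (by ext e; simp [H e])

/-! ### Sums of separated blocks -/

/-- For `δ > 2N` the windows of radius `N` around distinct multiples of `δ` are disjoint, so only
one summand contributes. The index `i` may lie outside `s`, which lets empty blocks be read off as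
well. -/
theorem coeff_sum_blocks {ι : Type*} (s : Finset ι) {φ : ι → ℤ} (hφ : Function.Injective φ)
    {h : ι → Laurent} {N : ℕ} (hN : ∀ i, BlockWidth N (h i)) {δ : ℤ} (hδ : 2 * (N : ℤ) < δ)
    {i : ι} (hi : i ∉ s → h i = 0) {k : ℤ} (hk : |k| ≤ N) :
    (∑ j ∈ s, h j * LaurentPolynomial.T (φ j * δ)).coeff (φ i * δ + k) = (h i).coeff k := by
  rw [AddMonoidAlgebra.coeff_sum, Finset.sum_apply', Finset.sum_eq_single i]
  · rw [coeff_mul_T, add_sub_cancel_left]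
  · intro j _ hji
    rw [coeff_mul_T]
    by_contra H
    have h1 := abs_le.1 (hN j _ H)
    have h2 := abs_le.1 hk
    rcases lt_or_gt_of_ne (hφ.ne hji) with h3 | h3
    · nlinarith
    · nlinarith
  · intro his
    rw [hi his, zero_mul, AddMonoidAlgebra.coeff_zero, Finsupp.coe_zero, Pi.zero_apply]

theorem exists_of_coeff_sum_blocks_ne_zero {ι : Type*} {s : Finset ι} {φ : ι → ℤ}
    {h : ι → Laurent} {N : ℕ} (hN : ∀ i, BlockWidth N (h i)) {δ e : ℤ}
    (he : (∑ j ∈ s, h j * LaurentPolynomial.T (φ j * δ)).coeff e ≠ 0) :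
    ∃ j ∈ s, |e - φ j * δ| ≤ N := by
  rw [AddMonoidAlgebra.coeff_sum, Finset.sum_apply'] at he
  obtain ⟨j, hj, hne⟩ := Finset.exists_ne_zero_of_sum_ne_zero he
  rw [coeff_mul_T] at hne
  exact ⟨j, hj, hN j _ hne⟩

theorem eval_T (Q : Laurent[X]) (δ : ℤ) : Q.eval (LaurentPolynomial.T δ) =
    ∑ j ∈ Finset.range (Q.natDegree + 1), Q.coeff j * LaurentPolynomial.T ((j : ℤ) * δ) := by
  rw [Polynomial.eval_eq_sum_range]
  simp only [LaurentPolynomial.T_pow]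

theorem coeff_eval_T {Q : Laurent[X]} {N : ℕ} (hN : ∀ i, BlockWidth N (Q.coeff i)) {δ : ℤ}
    (hδ : 2 * (N : ℤ) < δ) (i : ℕ) {k : ℤ} (hk : |k| ≤ N) :
    (Q.eval (LaurentPolynomial.T δ)).coeff (i * δ + k) = (Q.coeff i).coeff k := by
  rw [eval_T]
  refine coeff_sum_blocks (φ := fun n : ℕ => (n : ℤ)) _ Nat.cast_injective hN hδ (fun hi => ?_) hk
  refine Polynomial.coeff_eq_zero_of_natDegree_lt ?_
  simpa [Nat.lt_succ_iff] using hi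

theorem eval_T_ne_zero {Q : Laurent[X]} (hQ : Q ≠ 0) {N : ℕ} (hN : ∀ i, BlockWidth N (Q.coeff i))
    {δ : ℤ} (hδ : 2 * (N : ℤ) < δ) : Q.eval (LaurentPolynomial.T δ) ≠ 0 := by
  intro H
  obtain ⟨e, he⟩ := exists_coeff_ne_zero (Polynomial.leadingCoeff_ne_zero.2 hQ)
  refine he ?_
  rw [Polynomial.leadingCoeff, ← coeff_eval_T hN hδ _ (hN _ e he), H]
  rfl

/-- If `F` divides `G` after specialisation at a large exponent, its degree is not much larger. -/
theorem natDegree_span_le {F G : Laurent[X]} (hF : F.coeff 0 ≠ 0) (hG : G ≠ 0) {A B : ℕ}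
    (hA : ∀ i, BlockWidth A (F.coeff i)) (hB : ∀ i, BlockWidth B (G.coeff i)) {δ : ℤ}
    (hδA : 2 * (A : ℤ) < δ) (hδB : 2 * (B : ℤ) < δ)
    (hdvd : F.eval (LaurentPolynomial.T δ) ∣ G.eval (LaurentPolynomial.T δ)) :
    (F.natDegree : ℤ) * δ ≤ G.natDegree * δ + 2 * (A + B) := by
  have hF0 : F ≠ 0 := by rintro rfl; simp at hF
  obtain ⟨l, hl⟩ := exists_coeff_ne_zero hF
  obtain ⟨u, hu⟩ := exists_coeff_ne_zero (Polynomial.leadingCoeff_ne_zero.2 hF0)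
  have hl' := hA _ l hl
  have hu' := hA _ u hu
  -- The first and last blocks of `F` give a span of at least `F.natDegree * δ - 2A`; that of `G` is
  -- at most `G.natDegree * δ + 2B`.
  have h := span_le_of_dvd hdvd (eval_T_ne_zero hG hB hδB) (l := ((0 : ℕ) : ℤ) * δ + l)
    (u := (F.natDegree : ℤ) * δ + u) (x := -B) (y := G.natDegree * δ + B)
    (by rwa [coeff_eval_T hA hδA _ hl']) (by rwa [coeff_eval_T hA hδA _ hu']) (by
      intro e he
      rw [eval_T] at he
      obtain ⟨j, hj, hje⟩ := exists_of_coeff_sum_blocks_ne_zero (φ := fun n : ℕ => (n : ℤ)) hB he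
      have hj' : (j : ℤ) ≤ G.natDegree := by
        exact_mod_cast Nat.lt_succ_iff.1 (Finset.mem_range.1 hj)
      have := abs_le.1 hje
      have h0 : 0 ≤ (j : ℤ) * δ := by
        have : 0 ≤ δ := by omega
        positivity
      have h1 : (j : ℤ) * δ ≤ G.natDegree * δ := mul_le_mul_of_nonneg_right hj' (by omega)
      omega)
  rw [abs_le] at hl' hu'
  simp only [Nat.cast_zero, zero_mul, zero_add] at h
  omega

/-! ### Pseudo-division -/

/-- Each step replaces `G` by `c G - a X^n F`, where `a` is the coefficient of `G` to be cancelled.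
This widens the coefficients by at most `A`. -/
theorem exists_pseudo_div {F : Laurent[X]} {A : ℕ} (hA : ∀ i, BlockWidth A (F.coeff i)) (n : ℕ) :
    ∀ (B : ℕ) (G : Laurent[X]), (∀ i, BlockWidth B (G.coeff i)) →
      (∀ i, F.natDegree + n ≤ i → G.coeff i = 0) →
      ∃ Q r : Laurent[X], Polynomial.C (F.leadingCoeff ^ n) * G = F * Q + r ∧
        (∀ i, F.natDegree ≤ i → r.coeff i = 0) ∧
        (∀ j, F.leadingCoeff ^ j ∣ Q.coeff j) ∧
        ∀ i, BlockWidth (B + n * A) (r.coeff i) := by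
  induction n with
  | zero =>
    intro B G hB hG
    exact ⟨0, G, by simp, by simpa using hG, by simp, by simpa using hB⟩
  | succ n ih =>
    intro B G hB hG
    set c := F.leadingCoeff with hc
    set a := G.coeff (F.natDegree + n) with ha
    have hmono : ∀ i, (F * (Polynomial.C a * Polynomial.X ^ n)).coeff i =
        if n ≤ i then a * F.coeff (i - n) else 0 := by
      intro i
      rw [mul_left_comm, Polynomial.coeff_C_mul, Polynomial.coeff_mul_X_pow']
      split_ifs <;> simp
    obtain ⟨Q, r, h1, h2, h3, h4⟩ := ih (B + A)
      (Polynomial.C c * G - F * (Polynomial.C a * Polynomial.X ^ n)) (by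
        intro i
        rw [Polynomial.coeff_sub, Polynomial.coeff_C_mul, hmono]
        refine BlockWidth.sub ?_ ?_
        · rw [add_comm B A]
          exact (hA _).mul (hB i)
        · split_ifs
          · exact (hB _).mul (hA _)
          · exact BlockWidth.zero _) (by
        intro i hi
        rw [Polynomial.coeff_sub, Polynomial.coeff_C_mul, hmono, if_pos (by omega)]
        rcases hi.eq_or_lt with rfl | hi
        · rw [Nat.add_sub_cancel, ← ha, hc, Polynomial.leadingCoeff, mul_comm, sub_self]
        · rw [hG i (by omega), Polynomial.coeff_eq_zero_of_natDegree_lt (n := i - n) (by omega)]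
          simp)
    -- The term `a X^n` is multiplied by `c` in each of the `n` remaining steps; this is why `c^j`
    -- divides the `j`-th quotient coefficient.
    refine ⟨Q + Polynomial.C (c ^ n * a) * Polynomial.X ^ n, r, ?_, h2, ?_, ?_⟩
    · rw [pow_succ, Polynomial.C_mul, Polynomial.C_mul]
      linear_combination h1
    · intro j
      rw [Polynomial.coeff_add, Polynomial.coeff_C_mul_X_pow]
      refine dvd_add (h3 j) ?_
      split_ifs with hj
      · rw [hj]; exact dvd_mul_right _ _
      · exact dvd_zero _
    · intro i
      rw [Nat.succ_mul, add_comm (n * A), ← add_assoc]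
      exact h4 i

theorem eval_T_sub_dvd {Q : Laurent[X]} {c : Laurent} {n R : ℕ} (hQ : ∀ j, c ^ j ∣ Q.coeff j)
    (hc : c ^ n ∣ LaurentPolynomial.T (R : ℤ) - 1) (δ : ℤ) (k : ℕ) :
    c ^ (n + 1) ∣ Q.eval (LaurentPolynomial.T (δ + R * k)) - Q.eval (LaurentPolynomial.T δ) := by
  rw [eval_T, eval_T, ← Finset.sum_sub_distrib]
  refine Finset.dvd_sum fun j _ => ?_
  rw [← mul_sub]
  -- The constant term does not change. For `j ≥ 1` one factor `c` comes from `Q.coeff j` and the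
  -- other `n` from the difference of powers of `z`.
  rcases Nat.eq_zero_or_pos j with rfl | hj
  · simp
  · have h1 : c ^ n ∣ LaurentPolynomial.T ((j : ℤ) * (δ + R * k)) -
        LaurentPolynomial.T ((j : ℤ) * δ) := by
      have h2 : (LaurentPolynomial.T ((j : ℤ) * (δ + R * k)) : Laurent) =
          LaurentPolynomial.T ((j : ℤ) * δ) * LaurentPolynomial.T (R : ℤ) ^ (j * k) := by
        rw [LaurentPolynomial.T_pow, ← LaurentPolynomial.T_add]
        congr 1
        push_cast
        ring
      rw [h2, ← mul_sub_one]
      exact ((hc.trans (sub_one_dvd_pow_sub_one _ _)).mul_left _)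
    rw [pow_succ']
    exact mul_dvd_mul ((dvd_pow_self c hj.ne').trans (hQ j)) h1

/-- Divisibility at one large value propagates along an arithmetic progression. -/
theorem eval_T_dvd_of_large {F G : Laurent[X]} (hF : F.coeff 0 ≠ 0) {A B n R : ℕ}
    (hA : ∀ i, BlockWidth A (F.coeff i)) (hB : ∀ i, BlockWidth B (G.coeff i))
    (hG : ∀ i, F.natDegree + (n + 1) ≤ i → G.coeff i = 0)
    (hc : F.leadingCoeff ^ n ∣ LaurentPolynomial.T (R : ℤ) - 1) {δ : ℤ} (k : ℕ)
    (hδ : 2 * ((A : ℤ) + (B + (n + 1) * A)) < δ + R * k)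
    (hdvd : F.eval (LaurentPolynomial.T (δ + R * k)) ∣ G.eval (LaurentPolynomial.T (δ + R * k))) :
    F.eval (LaurentPolynomial.T δ) ∣ G.eval (LaurentPolynomial.T δ) := by
  have hF0 : F ≠ 0 := by rintro rfl; simp at hF
  have hc0 : F.leadingCoeff ≠ 0 := Polynomial.leadingCoeff_ne_zero.2 hF0
  obtain ⟨Q, r, h1, h2, h3, h4⟩ := exists_pseudo_div hA (n + 1) B G hB hG
  have h5 : ∀ x : Laurent, F.leadingCoeff ^ (n + 1) * G.eval x = F.eval x * Q.eval x + r.eval x := by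
    intro x
    have := congrArg (Polynomial.eval x) h1
    simpa using this
  have hnA : 0 ≤ ((n : ℤ) + 1) * A := by positivity
  have hδA : 2 * (A : ℤ) < δ + R * k := by omega
  -- A nonzero `r` has degree at least one lower than `F`. That costs a full `δ + R * k`, more than
  -- the widths `A` and `B + (n + 1) * A` can make up.
  have hr : r = 0 := by
    by_contra hr
    have h6 := natDegree_span_le hF hr hA h4 hδA (by push_cast; omega)
      ((dvd_add_right (dvd_mul_right _ _)).1 (h5 _ ▸ hdvd.mul_left _))
    have h7 : r.natDegree < F.natDegree := by
      by_contra! h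
      exact hr (Polynomial.leadingCoeff_eq_zero.1 (h2 _ h))
    have h8 : ((r.natDegree : ℤ) + 1) * (δ + R * k) ≤ F.natDegree * (δ + R * k) :=
      mul_le_mul_of_nonneg_right (by exact_mod_cast h7) (by omega)
    push_cast at h6
    linarith
  simp only [hr, Polynomial.eval_zero, add_zero] at h5
  obtain ⟨q, hq⟩ := hdvd
  have h6 : F.leadingCoeff ^ (n + 1) ∣ Q.eval (LaurentPolynomial.T (δ + R * k)) := by
    refine ⟨q, mul_left_cancel₀ (eval_T_ne_zero hF0 hA hδA) ?_⟩
    rw [← h5, hq]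
    ring
  obtain ⟨q', hq'⟩ := (dvd_sub_right h6).1 (eval_T_sub_dvd h3 hc δ k)
  refine ⟨q', mul_left_cancel₀ (pow_ne_zero (n + 1) hc0) ?_⟩
  rw [h5, hq']
  ring

/-! ### The return exponent of the division automaton -/

theorem mk_step (F s : (ZMod 2)[X]) (b : ZMod 2) :
    AdjoinRoot.mk F (step F s b) = AdjoinRoot.mk F s * AdjoinRoot.root F + AdjoinRoot.of F b := by
  have h : AdjoinRoot.mk F (step F s b) = AdjoinRoot.mk F (s * Polynomial.X + Polynomial.C b) := by
    rw [AdjoinRoot.mk_eq_mk, step, EuclideanDomain.mod_eq_sub_mul_div, sub_sub_cancel_left, dvd_neg]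
    exact dvd_mul_right _ _
  rw [h, map_add, map_mul, AdjoinRoot.mk_X, AdjoinRoot.mk_C]

theorem mk_run_replicate_zero (F s : (ZMod 2)[X]) (n : ℕ) :
    AdjoinRoot.mk F (run F s (List.replicate n 0)) =
      AdjoinRoot.mk F s * AdjoinRoot.root F ^ n := by
  induction n generalizing s with
  | zero => simp [run]
  | succ n ih =>
    have : run F s (List.replicate (n + 1) 0) = run F (step F s 0) (List.replicate n 0) := rfl
    rw [this, ih, mk_step, map_zero, add_zero, pow_succ', mul_assoc]

theorem root_pow_eq_one_of_isReturnExponent {F : (ZMod 2)[X]} {P : ℕ} (hP : IsReturnExponent F P)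
    (hF : 0 < F.degree) : AdjoinRoot.root F ^ P = 1 := by
  -- Reading `0` multiplies the state by the root; `1` is a legal state because `F` is not constant.
  have h := hP.2 [0] 1 (by rwa [Polynomial.degree_one])
  have h2 := mk_run_replicate_zero F 1 P
  have h3 : (List.replicate P [(0 : ZMod 2)]).flatten = List.replicate P 0 := by simp
  rw [h3] at h
  rw [h, map_one, one_mul] at h2
  exact h2.symm

theorem even_of_isReturnExponent {F : (ZMod 2)[X]} {P : ℕ} (hP : IsReturnExponent F P)
    (hF : 0 < F.degree) : Even P := by
  have hroot := root_pow_eq_one_of_isReturnExponent hP hF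
  -- Since the `P`-th power of the root is `1`, this word of length `P` acts as `s ↦ s + 1`. Reading
  -- it `P` times adds `P`, which must vanish modulo 2.
  set w : List (ZMod 2) := List.replicate (P - 1) 0 ++ [1]
  have hw : ∀ s, AdjoinRoot.mk F (run F s w) = AdjoinRoot.mk F s + 1 := by
    intro s
    have : run F s w = step F (run F s (List.replicate (P - 1) 0)) 1 := by simp [run, w]
    rw [this, mk_step, mk_run_replicate_zero, mul_assoc, ← pow_succ, Nat.sub_add_cancel hP.1,
      hroot, mul_one, map_one]
  have hk : ∀ (k : ℕ) s, AdjoinRoot.mk F (run F s (List.replicate k w).flatten) =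
      AdjoinRoot.mk F s + k := by
    intro k
    induction k with
    | zero => intro s; simp [run]
    | succ k ih =>
      intro s
      have : run F s (List.replicate (k + 1) w).flatten =
          run F (run F s w) (List.replicate k w).flatten := by
        simp [run, List.replicate_succ]
      rw [this, ih, hw]
      push_cast
      ring
  have h := hk P 0
  rw [hP.2 w 0 (by rw [Polynomial.degree_zero]; exact bot_le.trans_lt hF), left_eq_add,
    ← map_natCast (AdjoinRoot.mk F), AdjoinRoot.mk_eq_zero, ← Polynomial.C_eq_natCast] at h
  have h0 : Polynomial.C ((P : ZMod 2)) = 0 :=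
    Polynomial.eq_zero_of_dvd_of_degree_lt h (Polynomial.degree_C_le.trans_lt hF)
  rw [Polynomial.C_eq_zero] at h0
  exact ZMod.natCast_eq_zero_iff_even.1 h0

/-- As `P = 2m` is even, passing from `P^k` to `P^(k+1)` includes a squaring, and in characteristic
2 `y^2 - 1 = (y - 1)^2`. The multiplicity of `F` thus at least doubles, and `2k ≥ k + 1` once `k ≥
1`. -/
theorem pow_dvd_X_pow_sub_one {F : (ZMod 2)[X]} (hF0 : F ≠ 0) {P : ℕ} (hP : IsReturnExponent F P)
    (k : ℕ) : F ^ k ∣ Polynomial.X ^ P ^ k - 1 := by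
  by_cases hF : 0 < F.degree
  · have h1 : F ∣ Polynomial.X ^ P - 1 := by
      rw [← AdjoinRoot.mk_eq_zero, map_sub, map_pow, AdjoinRoot.mk_X, map_one,
        root_pow_eq_one_of_isReturnExponent hP hF, sub_self]
    obtain ⟨m, hm⟩ := even_of_isReturnExponent hP hF
    induction k with
    | zero => simp
    | succ k ih =>
      rcases Nat.eq_zero_or_pos k with rfl | hk
      · simpa using h1
      · have h2 : (Polynomial.X : (ZMod 2)[X]) ^ P ^ (k + 1) - 1 =
            ((Polynomial.X ^ P ^ k) ^ m - 1) ^ 2 := by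
          rw [sub_sq, pow_succ, pow_mul]
          nth_rw 2 [hm]
          have h3 : (2 : (ZMod 2)[X]) = 0 := CharTwo.two_eq_zero
          linear_combination (1 - (Polynomial.X ^ P ^ k : (ZMod 2)[X]) ^ m) * -h3
        rw [h2]
        refine (pow_dvd_pow F (by omega : k + 1 ≤ k * 2)).trans ?_
        rw [pow_mul]
        exact pow_dvd_pow_of_dvd (ih.trans (sub_one_dvd_pow_sub_one _ _)) 2
  -- A nonzero constant `F` is a unit; here `P` need not be even.
  · exact ((Polynomial.isUnit_iff_degree_eq_zero.2
      (le_antisymm (not_lt.1 hF) (Polynomial.zero_le_degree_iff.2 hF0))).pow k).dvd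

theorem toLaurent_toPoly (h : Laurent) :
    Polynomial.toLaurent (toPoly h) * LaurentPolynomial.T (order h) = h := by
  have hle : ∀ j ∈ h.coeff.support, order h ≤ j := by
    intro j hj
    rw [order, minIdx, dif_pos ⟨j, hj⟩]
    exact Finset.min'_le _ _ hj
  rw [toPoly, map_sum, Finset.sum_mul]
  conv_rhs => rw [← AddMonoidAlgebra.sum_coeff_single h]
  refine Finset.sum_congr rfl fun j hj => ?_
  have := hle j hj
  rw [Polynomial.toLaurent_C_mul_T, LaurentPolynomial.mul_T_assoc,
    LaurentPolynomial.single_eq_C_mul_T]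
  congr 2
  omega

theorem pow_dvd_T_sub_one {h : Laurent} (hh : h ≠ 0) (k : ℕ) :
    h ^ k ∣ LaurentPolynomial.T ((periodConst h ^ k : ℕ) : ℤ) - 1 := by
  have hF0 : toPoly h ≠ 0 := fun H => toPoly_coeff_zero hh (by rw [H, Polynomial.coeff_zero])
  have h1 := map_dvd Polynomial.toLaurent (pow_dvd_X_pow_sub_one hF0 (periodConst_spec hh) k)
  rw [map_pow, map_sub, Polynomial.toLaurent_X_pow, map_one] at h1
  conv_lhs => rw [← toLaurent_toPoly h, mul_pow]
  exact (((LaurentPolynomial.isUnit_T _).pow k).mul_right_dvd).2 h1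

/-! ### Parametric polynomials as polynomials in the power `z ^ δ` -/

theorem ordδ_le {f : ParamPoly} {i : ℤ} (hi : f i ≠ 0) : ordδ f ≤ i := by
  rw [ordδ, minIdx, dif_pos ⟨i, Finsupp.mem_support_iff.2 hi⟩]
  exact Finset.min'_le _ _ (Finsupp.mem_support_iff.2 hi)

theorem le_degδ {f : ParamPoly} {i : ℤ} (hi : f i ≠ 0) : i ≤ degδ f := by
  rw [degδ, maxIdx, dif_pos ⟨i, Finsupp.mem_support_iff.2 hi⟩]
  exact Finset.le_max' _ _ (Finsupp.mem_support_iff.2 hi)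

theorem apply_ordδ_ne_zero {f : ParamPoly} (hf : f ≠ 0) : f (ordδ f) ≠ 0 := by
  rw [← Finsupp.mem_support_iff, ordδ, minIdx, dif_pos (Finsupp.support_nonempty_iff.2 hf)]
  exact Finset.min'_mem _ _

theorem apply_degδ_ne_zero {f : ParamPoly} (hf : f ≠ 0) : f (degδ f) ≠ 0 := by
  rw [← Finsupp.mem_support_iff, degδ, maxIdx, dif_pos (Finsupp.support_nonempty_iff.2 hf)]
  exact Finset.max'_mem _ _

/-- The polynomial whose coefficients are the blocks of `f`, starting with the first nonzero one. -/
noncomputable def blockPoly (f : ParamPoly) : Laurent[X] :=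
  ∑ i ∈ f.support, Polynomial.monomial (i - ordδ f).toNat (f i)

theorem coeff_blockPoly (f : ParamPoly) (n : ℕ) : (blockPoly f).coeff n = f (n + ordδ f) := by
  rw [blockPoly, Polynomial.finsetSum_coeff, Finset.sum_eq_single (n + ordδ f)]
  · rw [add_sub_cancel_right, Int.toNat_natCast, Polynomial.coeff_monomial, if_pos rfl]
  · intro j hj hne
    have := ordδ_le (Finsupp.mem_support_iff.1 hj)
    rw [Polynomial.coeff_monomial, if_neg]
    omega
  · intro h
    rw [Finsupp.notMem_support_iff.1 h, map_zero, Polynomial.coeff_zero]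

theorem coeff_zero_blockPoly_ne_zero {f : ParamPoly} (hf : f ≠ 0) : (blockPoly f).coeff 0 ≠ 0 := by
  rw [coeff_blockPoly, Nat.cast_zero, zero_add]
  exact apply_ordδ_ne_zero hf

theorem natDegree_blockPoly {f : ParamPoly} (hf : f ≠ 0) :
    ((blockPoly f).natDegree : ℤ) = degδ f - ordδ f := by
  have hle := ordδ_le (apply_degδ_ne_zero hf)
  have h : (blockPoly f).natDegree = (degδ f - ordδ f).toNat := by
    apply le_antisymm
    · refine Polynomial.natDegree_le_iff_coeff_eq_zero.2 fun n hn => ?_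
      rw [coeff_blockPoly]
      by_contra h
      have := le_degδ h
      omega
    · refine Polynomial.le_natDegree_of_ne_zero ?_
      rw [coeff_blockPoly, Int.toNat_of_nonneg (by omega), sub_add_cancel]
      exact apply_degδ_ne_zero hf
  omega

theorem leadingCoeff_blockPoly {f : ParamPoly} (hf : f ≠ 0) :
    (blockPoly f).leadingCoeff = f (degδ f) := by
  rw [Polynomial.leadingCoeff, coeff_blockPoly, natDegree_blockPoly hf, sub_add_cancel]

theorem inst_eq_eval (f : ParamPoly) (δ : ℤ) :
    inst f δ = (blockPoly f).eval (LaurentPolynomial.T δ) * LaurentPolynomial.T (ordδ f * δ) := by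
  rw [inst, Finsupp.sum, blockPoly, Polynomial.eval_finsetSum, Finset.sum_mul]
  refine Finset.sum_congr rfl fun i hi => ?_
  have := ordδ_le (Finsupp.mem_support_iff.1 hi)
  rw [Polynomial.eval_monomial, LaurentPolynomial.T_pow, LaurentPolynomial.mul_T_assoc,
    Int.toNat_of_nonneg (by omega)]
  congr 2
  ring

theorem inst_dvd_iff (f g : ParamPoly) (δ : ℤ) : inst f δ ∣ inst g δ ↔
    (blockPoly f).eval (LaurentPolynomial.T δ) ∣ (blockPoly g).eval (LaurentPolynomial.T δ) := by
  rw [inst_eq_eval, inst_eq_eval, (LaurentPolynomial.isUnit_T _).mul_right_dvd,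
    (LaurentPolynomial.isUnit_T _).dvd_mul_right]

/-! ### The blocks of a piecewise periodic parametric polynomial -/

theorem blockWidth_of_isPiecewisePeriodic {f : ParamPoly} {A : ℕ}
    (h : IsPiecewisePeriodic A 1 (fun δ : ℕ => inst f (δ : ℤ))) (i : ℤ) :
    BlockWidth A (f i) := by
  obtain ⟨-, s, t, n, u, D, -, -, H⟩ := h
  obtain ⟨M, hM⟩ : ∃ M : ℕ, ∀ i, BlockWidth M (f i) := by
    choose N hN using fun i => exists_blockWidth (f i)
    refine ⟨f.support.sup N, fun i => ?_⟩
    by_cases hi : f i = 0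
    · rw [hi]; exact BlockWidth.zero _
    · exact (hN i).mono (Finset.le_sup (Finsupp.mem_support_iff.2 hi))
  -- The crude bound `M` is enlarged so that the window of radius `N` reaches offset `A + 1 + M`, a
  -- gap position outside every block.
  set N := M + A + 1 with hN
  have hfN : ∀ i, BlockWidth N (f i) := fun i => (hM i).mono (by omega)
  set δ := D + 2 * N + 2 * A + 2 with hδ
  have hcoeff : ∀ (i k : ℤ), |k| ≤ N → (inst f (δ : ℤ)).coeff (i * δ + k) = (f i).coeff k :=
    fun i k hk => coeff_sum_blocks f.support (φ := id) Function.injective_id hfN (by omega)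
      Finsupp.notMem_support_iff.1 hk
  obtain ⟨-, hgap, hout⟩ := H δ (by omega)
  -- Every gap is filled with one repeated bit, which vanishes because the blocks are bounded.
  have hzero : ∀ i, s ≤ i → i < t → u i 0 = 0 := by
    intro i h1 h2
    rw [← hgap i h1 h2 M 0 (by omega) (by simp [Nat.mod_one])]
    have h3 := hcoeff i (A + 1 + M) (by rw [abs_of_nonneg] <;> omega)
    rw [← add_assoc, ← add_assoc] at h3
    rw [h3]
    by_contra h4
    have := abs_le.1 (hM i _ h4)
    omega
  intro k hk
  have hkM := hM i k hk
  have hc := hcoeff i k (hkM.trans (by omega))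
  rw [← hc] at hk
  rw [abs_le] at hkM
  by_contra hkA
  -- An offset `k > A` falls into the gap after block `i`, an offset `k < -A` into the gap before
  -- it, or else outside the whole string. The coefficient vanishes in every case.
  rcases lt_abs.1 (not_le.1 hkA) with h1 | h1
  · rcases lt_or_ge i s with h2 | h2
    · refine hk (hout _ (Or.inl ?_))
      nlinarith
    · rcases lt_or_ge i t with h3 | h3
      · have := hgap i h2 h3 (k - A - 1).toNat 0 (by omega) (by simp [Nat.mod_one])
        rw [hzero i h2 h3] at this
        refine hk (Eq.trans ?_ this)
        congr 1
        omega
      · refine hk (hout _ (Or.inr ?_))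
        nlinarith
  · rcases le_or_gt i s with h2 | h2
    · refine hk (hout _ (Or.inl ?_))
      nlinarith
    · rcases le_or_gt i t with h3 | h3
      · have := hgap (i - 1) (by omega) (by omega) (δ + k - A - 1).toNat 0 (by omega)
          (by simp [Nat.mod_one])
        rw [hzero (i - 1) (by omega) (by omega)] at this
        refine hk (Eq.trans ?_ this)
        rw [sub_mul, one_mul]
        congr 1
        omega
      · refine hk (hout _ (Or.inr ?_))
        nlinarith

/-! ### Positive values of the parameter -/

theorem exists_small_of_nonneg {f g : ParamPoly} (hf : f ≠ 0) (hg : g ≠ 0) {A B Δ : ℕ}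
    (hA : ∀ i, BlockWidth A (f i)) (hB : ∀ i, BlockWidth B (g i))
    (hΔ : spanDiff f g = Δ) {δ : ℤ} (hδ : 0 ≤ δ) (hdvd : inst f δ ∣ inst g δ) :
    ∃ δ' : ℤ, inst f δ' ∣ inst g δ' ∧ 0 ≤ δ' ∧
      δ' ≤ ((periodConst (f (degδ f)) ^ Δ + 2 * (B + 4 * A * Δ) + 4 * A + 1 : ℕ) : ℤ) := by
  set R := periodConst (f (degδ f)) ^ Δ with hR
  have hRpos : 0 < R := pow_pos (periodConst_spec (apply_degδ_ne_zero hf)).1 Δ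
  by_cases hsmall : δ ≤ ((R + 2 * (B + 4 * A * Δ) + 4 * A + 1 : ℕ) : ℤ)
  · exact ⟨δ, hdvd, hδ, hsmall⟩
  have hmod : δ % R + R * ((δ / R).toNat : ℤ) = δ := by
    rw [Int.toNat_of_nonneg (Int.ediv_nonneg hδ (by omega))]
    exact Int.emod_add_mul_ediv δ R
  refine ⟨δ % R, ?_, Int.emod_nonneg _ (by omega), ?_⟩
  · rw [inst_dvd_iff] at hdvd ⊢
    refine eval_T_dvd_of_large (coeff_zero_blockPoly_ne_zero hf) (A := A) (B := B) (n := Δ) (R := R)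
      (fun i => ?_) (fun i => ?_) (fun i hi => ?_) ?_ (δ / R).toNat ?_ (hmod.symm ▸ hdvd)
    · rw [coeff_blockPoly]; exact hA _
    · rw [coeff_blockPoly]; exact hB _
    · refine Polynomial.coeff_eq_zero_of_natDegree_lt ?_
      have h1 := natDegree_blockPoly hf
      have h2 := natDegree_blockPoly hg
      rw [spanDiff] at hΔ
      omega
    · rw [leadingCoeff_blockPoly hf]
      exact pow_dvd_T_sub_one (apply_degδ_ne_zero hf) Δ
    -- The threshold needed is `2(A + B + (Δ + 1)A) = 2B + 2AΔ + 4A`, which the stated bound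
    -- exceeds.
    · rw [hmod]
      push_cast at hsmall
      have : 0 ≤ (A : ℤ) * Δ := by positivity
      nlinarith
  · have := Int.emod_lt_of_pos δ (by omega : (0 : ℤ) < R)
    push_cast
    have : 0 ≤ (A : ℤ) * Δ := by positivity
    nlinarith

theorem le_of_dvd_of_spanDiff_neg {f g : ParamPoly} (hf : f ≠ 0) (hg : g ≠ 0) {A B : ℕ}
    (hA : ∀ i, BlockWidth A (f i)) (hB : ∀ i, BlockWidth B (g i))
    (hΔ : spanDiff f g < 0) {δ : ℤ} (hdvd : inst f δ ∣ inst g δ) : δ ≤ 2 * (B : ℤ) + 2 * A := by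
  by_contra! hδ
  have hg0 : blockPoly g ≠ 0 := fun H =>
    coeff_zero_blockPoly_ne_zero hg (by rw [H, Polynomial.coeff_zero])
  have h := natDegree_span_le (coeff_zero_blockPoly_ne_zero hf) hg0 (A := A) (B := B)
    (fun i => by rw [coeff_blockPoly]; exact hA _) (fun i => by rw [coeff_blockPoly]; exact hB _)
    (by omega) (by omega) ((inst_dvd_iff f g δ).1 hdvd)
  rw [natDegree_blockPoly hf, natDegree_blockPoly hg] at h
  rw [spanDiff] at hΔ
  nlinarith

/-! ### Reversing the sign of the parameter -/

/-- The parametric polynomial obtained by the substitution `δ ↦ -δ`. -/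
noncomputable def reflect (f : ParamPoly) : ParamPoly := Finsupp.equivMapDomain (Equiv.neg ℤ) f

theorem reflect_apply (f : ParamPoly) (i : ℤ) : reflect f i = f (-i) := rfl

theorem reflect_ne_zero {f : ParamPoly} (hf : f ≠ 0) : reflect f ≠ 0 := by
  intro h
  refine apply_degδ_ne_zero hf ?_
  rw [← neg_neg (degδ f), ← reflect_apply, h, Finsupp.coe_zero, Pi.zero_apply]

theorem inst_reflect (f : ParamPoly) (δ : ℤ) : inst (reflect f) δ = inst f (-δ) := by
  rw [inst, reflect, Finsupp.sum_equivMapDomain, inst]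
  simp

theorem degδ_reflect {f : ParamPoly} (hf : f ≠ 0) : degδ (reflect f) = -ordδ f := by
  apply le_antisymm
  · have := ordδ_le (f := f) (i := -degδ (reflect f)) (apply_degδ_ne_zero (reflect_ne_zero hf))
    omega
  · exact le_degδ (by rw [reflect_apply, neg_neg]; exact apply_ordδ_ne_zero hf)

theorem ordδ_reflect {f : ParamPoly} (hf : f ≠ 0) : ordδ (reflect f) = -degδ f := by
  apply le_antisymm
  · exact ordδ_le (by rw [reflect_apply, neg_neg]; exact apply_degδ_ne_zero hf)
  · have := le_degδ (f := f) (i := -ordδ (reflect f)) (apply_ordδ_ne_zero (reflect_ne_zero hf))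
    omega

theorem spanDiff_reflect {f g : ParamPoly} (hf : f ≠ 0) (hg : g ≠ 0) :
    spanDiff (reflect f) (reflect g) = spanDiff f g := by
  rw [spanDiff, spanDiff, degδ_reflect hf, degδ_reflect hg, ordδ_reflect hf, ordδ_reflect hg]
  ring

end ParamDiv

theorem mainTheorem4 (f g : ParamDiv.ParamPoly) (hf : f ≠ 0) (hg : g ≠ 0) (A B : ℕ)
    (hfA : ParamDiv.IsPiecewisePeriodic A 1 (fun δ : ℕ => ParamDiv.inst f (δ : ℤ)))
    (hgB : ParamDiv.IsPiecewisePeriodic B 1 (fun δ : ℕ => ParamDiv.inst g (δ : ℤ)))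
    (hAB : A ≤ B)
    (hpos : ∃ δ : ℤ, ParamDiv.inst f δ ∣ ParamDiv.inst g δ) :
    (∀ Δ : ℕ, ParamDiv.spanDiff f g = (Δ : ℤ) →
      ∃ δ : ℤ, ParamDiv.inst f δ ∣ ParamDiv.inst g δ ∧
        -(((ParamDiv.periodConst (f (ParamDiv.ordδ f)) ^ Δ
            + 2 * (B + 4 * A * Δ) + 4 * A + 1 : ℕ) : ℤ)) ≤ δ ∧
        δ ≤ ((ParamDiv.periodConst (f (ParamDiv.degδ f)) ^ Δ
            + 2 * (B + 4 * A * Δ) + 4 * A + 1 : ℕ) : ℤ)) ∧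
    (ParamDiv.spanDiff f g < 0 →
      ∃ δ : ℤ, ParamDiv.inst f δ ∣ ParamDiv.inst g δ ∧
        -(2 * (B : ℤ) + 2 * A) ≤ δ ∧ δ ≤ 2 * (B : ℤ) + 2 * A) := by
  obtain ⟨δ, hdvd⟩ := hpos
  have hA := ParamDiv.blockWidth_of_isPiecewisePeriodic hfA
  have hB := ParamDiv.blockWidth_of_isPiecewisePeriodic hgB
  have hf' := ParamDiv.reflect_ne_zero hf
  have hg' := ParamDiv.reflect_ne_zero hg
  -- Periodicity concerns only `δ ≥ 0`, but the block widths it yields do not involve `δ` and so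
  -- pass to the reflections.
  have hA' : ∀ i, ParamDiv.BlockWidth A (ParamDiv.reflect f i) := fun i => hA (-i)
  have hB' : ∀ i, ParamDiv.BlockWidth B (ParamDiv.reflect g i) := fun i => hB (-i)
  have hspan := ParamDiv.spanDiff_reflect hf hg
  have hdvd' : ParamDiv.inst (ParamDiv.reflect f) (-δ) ∣
      ParamDiv.inst (ParamDiv.reflect g) (-δ) := by
    rwa [ParamDiv.inst_reflect, ParamDiv.inst_reflect, neg_neg]
  refine ⟨fun Δ hΔ => ?_, fun hΔ => ⟨δ, hdvd, ?_, ?_⟩⟩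
  · rcases le_total 0 δ with hδ | hδ
    · obtain ⟨δ', h1, h2, h3⟩ := ParamDiv.exists_small_of_nonneg hf hg hA hB hΔ hδ hdvd
      exact ⟨δ', h1, (neg_nonpos.2 (Nat.cast_nonneg _)).trans h2, h3⟩
    · obtain ⟨δ', h1, h2, h3⟩ := ParamDiv.exists_small_of_nonneg hf' hg' hA' hB'
        (hspan.trans hΔ) (neg_nonneg.2 hδ) hdvd'
      rw [ParamDiv.inst_reflect, ParamDiv.inst_reflect] at h1
      rw [ParamDiv.degδ_reflect hf, ParamDiv.reflect_apply, neg_neg] at h3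
      exact ⟨-δ', h1, neg_le_neg h3, (neg_nonpos.2 h2).trans (Nat.cast_nonneg _)⟩
  · have := ParamDiv.le_of_dvd_of_spanDiff_neg hf' hg' hA' hB' (hspan.trans_lt hΔ) hdvd'
    omega
  · exact ParamDiv.le_of_dvd_of_spanDiff_neg hf hg hA hB hΔ hdvd
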